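/- Let $F_0=0$, $F_1=1$, $F_n=F_{n-1}+F_{n-2}$ ($n\ge 2$) be the Fibonacci numbers. For positive integers $a_1,a_2,a_3$ with $\gcd(a_1,a_2,a_3)=1$, let $g_3(a_1,a_2,a_3)$ be the largest integer $n$ for which the equation $a_1x_1+a_2x_2+a_3x_3=n$ has at most $3$ solutions in nonnegative integers $x_1,x_2,x_3$. Then for every integer $i\ge 3$ we have \begin{align*} g_3(F_i,F_{i+2},F_{i+k})&=(4F_i-1)F_{i+2}-F_i\quad(k\ge i+3),\\ g_3(F_i,F_{i+2},F_{2i+2})&=(F_i-1)F_{i+2}+F_{2i+2}-F_i,\\ g_3(F_i,F_{i+2},F_{2i+1})&=(F_i+F_{i-2}-1)F_{i+2}+F_{2i+1}-F_i,\\ g_3(F_i,F_{i+2},F_{2i})&=(F_i-1)F_{i+2}+2F_{2i}-F_i,\\ g_3(F_i,F_{i+2},F_{2i-1})&=(F_{i-2}-1)F_{i+2}+3F_{2i-1}-F_i\quad(i\ge 4),\\ g_3(F_i,F_{i+2},F_{2i-2})&=\begin{cases}(F_{i-5}-1)F_{i+2}+5F_{2i-2}-F_i&(i\ge 6),\\ F_{i+2}+4F_{2i-2}-F_i\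 (=92)&(i=5).\end{cases} \end{align*} Moreover, let $k\ge 3$ be an integer and $r=\lfloor (F_i-1)/F_k\rfloor$. Then $r\ge 3$ if and only if $k\le i-3$, and in this case $$g_3(F_i,F_{i+2},F_{i+k})=\begin{cases}(F_i-rF_k-1)F_{i+2}+(r+3)F_{i+k}-F_i&\text{if }(F_i-rF_k)F_{i+2}\ge F_{k-2}F_i,\\ (F_k-1)F_{i+2}+(r+2)F_{i+k}-F_i&\text{if }(F_i-rF_k)F_{i+2}<F_{k-2}F_i.\end{cases}$$ -/

import Mathlib

/-- The number of representations of the integer `n` as `∑ j, x j * a j` with nonnegative integer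
coefficients `x j`, as an extended natural number. -/
noncomputable def numRepr {l : ℕ} (a : Fin l → ℕ) (n : ℤ) : ℕ∞ :=
  Set.encard {x : Fin l → ℕ | ∑ j, (x j : ℤ) * (a j : ℤ) = n}

/-- `g` is the `p`-Frobenius number of `a 0, …, a (l - 1)`: the largest integer that has at most
`p` representations as a nonnegative integer combination of these numbers. -/
def IsPFrobenius {l : ℕ} (p : ℕ) (a : Fin l → ℕ) (g : ℤ) : Prop :=
  IsGreatest {n : ℤ | numRepr a n ≤ (p : ℕ∞)} g

/-- The Fibonacci number `F_n` as an integer. -/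
def fibZ (n : ℕ) : ℤ := (Nat.fib n : ℤ)

/-- The triple `(F_i, F_{i+2}, F_m)` of Fibonacci numbers. -/
def fibTriple (i m : ℕ) : Fin 3 → ℕ := ![Nat.fib i, Nat.fib (i + 2), Nat.fib m]

/-! Put A = F_i, B = F_{i+2} and let C = F_{i+k} be the third number. The identity F_{i+k} = F_k
F_{i+2} - F_{k-2} F_i gives C = sB - tA with s = F_k, t = F_{k-2}, so C ≡ sB modulo A. Since A and B
are coprime, n ≡ jB for a unique residue j, and every solution of A x + B y + C z = n has y + s z =
j + qA for some q ≥ 0. The part yB + zC equals jB + A(qB - tz), so n has as many representations as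
there are admissible pairs (q, z) with contribution at most n. In the class of j the largest n with
at most three representations is therefore the fourth smallest contribution minus A, and g_3 is the
maximum M over j minus A (`IsMaxFourth.isPFrobenius`).

It remains to find M. In row q the contributions decrease with z, so the largest admissible z is
best. For large k only z = 0 matters. For k from i-2 to i+2 each case is a short linear analysis.
For k ≤ i-3 write A = rs + e with 1 ≤ e ≤ s and r ≥ 3: rows 0 and 1 suffice and produce two
candidates for M (`exists_four_contributions`), whose difference eB - tA decides the case split. -/

/-- Write `C = s B - t A`. A pair `(q, z)` with `0 ≤ z` and `s z ≤ j + q A` encodes the solutions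
with second coefficient `j + q A - s z` and third coefficient `z`, which contribute
`j B + A (q B - t z)`. The predicate says that `M` is the largest, over all residues `j` modulo
`A`, of the fourth smallest of these contributions. -/
structure IsMaxFourth (A B s t M : ℤ) : Prop where
  upper : ∀ j, 0 ≤ j → j < A → ∃ S : List (ℤ × ℤ), S.length = 4 ∧ S.Nodup ∧
    ∀ p ∈ S, 0 ≤ p.2 ∧ s * p.2 ≤ j + p.1 * A ∧ j * B + A * (p.1 * B - t * p.2) ≤ M
  lower : ∃ j, 0 ≤ j ∧ j < A ∧ A ∣ M - j * B ∧ ∃ T : List (ℤ × ℤ), T.length ≤ 3 ∧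
    ∀ q z, 0 ≤ q → 0 ≤ z → s * z ≤ j + q * A → j * B + A * (q * B - t * z) < M → (q, z) ∈ T

/-! ### From contributions to numbers of representations -/

lemma exists_residue {A B : ℕ} (hA : 0 < A) (hc : Nat.Coprime A B) (n : ℤ) :
    ∃ j : ℤ, 0 ≤ j ∧ j < A ∧ (A : ℤ) ∣ n - j * B := by
  have hA' : (0 : ℤ) < A := by exact_mod_cast hA
  obtain ⟨u, v, huv⟩ := (Int.isCoprime_iff_gcd_eq_one.2 (by simpa using hc) :
    IsCoprime (A : ℤ) (B : ℤ))
  refine ⟨(n * v) % A, Int.emod_nonneg _ hA'.ne', Int.emod_lt_of_pos _ hA', ?_⟩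
  refine ⟨n * u + B * (n * v / A), ?_⟩
  rw [Int.emod_def]
  linear_combination -n * huv

theorem IsMaxFourth.isPFrobenius {A B C : ℕ} {s t M : ℤ} (h : IsMaxFourth A B s t M)
    (hA : 0 < A) (hs : 0 ≤ s) (hc : Nat.Coprime A B) (hC : (C : ℤ) = s * B - t * A) :
    IsPFrobenius 3 ![A, B, C] (M - A) := by
  have hA' : (0 : ℤ) < A := by exact_mod_cast hA
  have hc' : IsCoprime (A : ℤ) (B : ℤ) := Int.isCoprime_iff_gcd_eq_one.2 (by simpa using hc)
  constructor
  · obtain ⟨j, hj0, hjA, ⟨c, hjM⟩, T, hT, hsub⟩ := h.lower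
    let f : (Fin 3 → ℕ) → ℤ × ℤ := fun x => ((x 1 + s * x 2 - j) / A, (x 2 : ℤ))
    have key : ∀ x : Fin 3 → ℕ, ∑ k, (x k : ℤ) * ((![A, B, C] k : ℕ) : ℤ) = M - A →
        (x 1 : ℤ) + s * x 2 = j + (f x).1 * A := by
      intro x hx
      simp only [Fin.sum_univ_three, Matrix.cons_val_zero, Matrix.cons_val_one,
        Matrix.cons_val] at hx
      -- Modulo A the equation reads (y + sz)B ≡ jB, and B is invertible.
      have hd : (A : ℤ) ∣ (x 1 + s * x 2 - j) * B := by
        refine ⟨c - 1 - x 0 + t * x 2, ?_⟩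
        rw [hC] at hx
        linear_combination hx + hjM
      have := Int.ediv_mul_cancel (hc'.dvd_of_dvd_mul_right hd)
      simp only [f]
      linarith
    have hmaps : Set.MapsTo f {x : Fin 3 → ℕ | ∑ k, (x k : ℤ) * ((![A, B, C] k : ℕ) : ℤ) = M - A}
        (T.toFinset : Set (ℤ × ℤ)) := by
      intro x hx
      have hk := key x hx
      simp only [Set.mem_ofPred_eq, Fin.sum_univ_three, Matrix.cons_val_zero, Matrix.cons_val_one,
        Matrix.cons_val] at hx
      have h0 : (0 : ℤ) ≤ x 0 := by positivity
      have h1 : (0 : ℤ) ≤ x 1 := by positivity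
      have h2 : (0 : ℤ) ≤ x 2 := by positivity
      -- A negative q would give j + qA < 0, because j < A.
      have hq : 0 ≤ (f x).1 := by
        by_contra hneg
        have : (f x).1 ≤ -1 := by omega
        nlinarith [mul_nonneg hs h2]
      have := hsub (f x).1 (x 2) hq h2 (by linarith) (by
        rw [hC] at hx
        have e : j * B + A * ((f x).1 * B - t * x 2) = M - A - x 0 * A := by
          linear_combination hx - B * hk
        rw [e]
        nlinarith)
      simpa using this
    have hinj : Set.InjOn f {x : Fin 3 → ℕ | ∑ k, (x k : ℤ) * ((![A, B, C] k : ℕ) : ℤ) = M - A} := by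
      intro x hx y hy hxy
      have hkx := key x hx
      have hky := key y hy
      simp only [Set.mem_ofPred_eq, Fin.sum_univ_three, Matrix.cons_val_zero, Matrix.cons_val_one,
        Matrix.cons_val] at hx hy
      have e2 : (x 2 : ℤ) = y 2 := congrArg Prod.snd hxy
      rw [hxy, e2] at hkx
      have e1 : (x 1 : ℤ) = y 1 := by linarith
      have e0 : (x 0 : ℤ) = y 0 := by
        rw [e1, e2] at hx
        exact mul_right_cancel₀ hA'.ne' (by linarith)
      funext k
      fin_cases k
      · exact_mod_cast e0
      · exact_mod_cast e1
      · exact_mod_cast e2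
    have := Set.encard_le_encard_of_injOn hmaps hinj
    refine this.trans ?_
    rw [Set.encard_coe_eq_coe_finsetCard]
    exact_mod_cast (List.toFinset_card_le T).trans hT
  · intro n hn
    by_contra hlt
    push Not at hlt
    obtain ⟨j, hj0, hjA, c, hjn⟩ := exists_residue hA hc n
    obtain ⟨S, hS, hnd, hmem⟩ := h.upper j hj0 hjA
    let f : ℤ × ℤ → (Fin 3 → ℕ) := fun p =>
      ![(c - (p.1 * B - t * p.2)).toNat, (j + p.1 * A - s * p.2).toNat, p.2.toNat]
    -- Each contribution is at most M < n + A and congruent to n modulo A, hence at most n.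
    have hx0 : ∀ p ∈ S, 0 ≤ c - (p.1 * B - t * p.2) := by
      intro p hp
      obtain ⟨-, -, h3⟩ := hmem p hp
      by_contra hneg
      have : c - (p.1 * B - t * p.2) ≤ -1 := by omega
      nlinarith
    have hmaps : Set.MapsTo f (S.toFinset : Set (ℤ × ℤ))
        {x : Fin 3 → ℕ | ∑ k, (x k : ℤ) * ((![A, B, C] k : ℕ) : ℤ) = n} := by
      intro p hp
      have hp' : p ∈ S := by simpa using hp
      obtain ⟨h1, h2, -⟩ := hmem p hp'
      simp only [Set.mem_ofPred_eq, Fin.sum_univ_three, Matrix.cons_val_zero, Matrix.cons_val_one,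
        Matrix.cons_val, f]
      rw [Int.toNat_of_nonneg (hx0 p hp'), Int.toNat_of_nonneg (by linarith),
        Int.toNat_of_nonneg h1, hC]
      linear_combination -hjn
    have hinj : Set.InjOn f (S.toFinset : Set (ℤ × ℤ)) := by
      intro p hp p' hp' hpp
      have hp : p ∈ S := by simpa using hp
      have hp' : p' ∈ S := by simpa using hp'
      obtain ⟨h1, h2, -⟩ := hmem p hp
      obtain ⟨h1', h2', -⟩ := hmem p' hp'
      have e2 : p.2.toNat = p'.2.toNat := congrFun hpp 2
      have e1 : (j + p.1 * A - s * p.2).toNat = (j + p'.1 * A - s * p'.2).toNat := congrFun hpp 1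
      have e2 : p.2 = p'.2 := by omega
      have e1 : p.1 * A = p'.1 * A := by
        have : j + p.1 * A - s * p.2 = j + p'.1 * A - s * p'.2 := by omega
        rw [e2] at this
        linarith
      exact Prod.ext (mul_right_cancel₀ hA'.ne' e1) e2
    have h4 := Set.encard_le_encard_of_injOn hmaps hinj
    rw [Set.encard_coe_eq_coe_finsetCard, List.toFinset_card_of_nodup hnd, hS] at h4
    have : ((4 : ℕ) : ℕ∞) ≤ (3 : ℕ) := h4.trans hn
    exact absurd (by exact_mod_cast this) (by norm_num : ¬ (4 : ℕ) ≤ 3)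

/-! ### Small third index: A = rs + e with r ≥ 3 -/

lemma contribution_le {A B s t M j q z : ℤ} (y : ℤ) (hy : y + s * z = j + q * A) (hy0 : 0 ≤ y)
    (hz : 0 ≤ z) (hM : y * B + z * (s * B - t * A) ≤ M) :
    0 ≤ z ∧ s * z ≤ j + q * A ∧ j * B + A * (q * B - t * z) ≤ M := by
  refine ⟨hz, by linarith, ?_⟩
  have : j * B + A * (q * B - t * z) = y * B + z * (s * B - t * A) := by
    linear_combination -B * hy
  rwa [this]

/-- The four contributions exist below any bound dominating the two candidates for the maximum,
when `A = r s + e` with `r ≥ 3`. -/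
lemma exists_four_contributions {A B s t r e M : ℤ} (hA : A = r * s + e) (he : 1 ≤ e) (hes : e ≤ s)
    (hr : 3 ≤ r) (hB : 2 * A ≤ B) (ht : 0 ≤ t) (hts : 2 * t ≤ s)
    (hM₁ : (e - 1) * B + (r + 3) * (s * B - t * A) ≤ M)
    (hM₂ : (s - 1) * B + (r + 2) * (s * B - t * A) ≤ M) (j : ℤ) (hj : 0 ≤ j) (hjA : j < A) :
    ∃ S : List (ℤ × ℤ), S.length = 4 ∧ S.Nodup ∧
      ∀ p ∈ S, 0 ≤ p.2 ∧ s * p.2 ≤ j + p.1 * A ∧ j * B + A * (p.1 * B - t * p.2) ≤ M := by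
  have hs : 0 < s := by linarith
  have hA0 : 0 < A := by linarith
  have hB0 : 0 ≤ B := by linarith
  have htA : 0 ≤ t * A := mul_nonneg ht hA0.le
  obtain ⟨C, hC⟩ : ∃ C, C = s * B - t * A := ⟨_, rfl⟩
  have h3 : 3 * (t * A) ≤ C := by
    have := mul_le_mul hts hB (by linarith) hs.le
    linarith
  rw [← hC] at hM₁ hM₂
  have hrC : 3 * C ≤ r * C := mul_le_mul_of_nonneg_right hr (by linarith)
  obtain ⟨h, l, hl, hls, hh, hjl⟩ : ∃ h l, 0 ≤ l ∧ l < s ∧ 0 ≤ h ∧ j = s * h + l :=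
    ⟨j / s, j % s, Int.emod_nonneg _ hs.ne', Int.emod_lt_of_pos _ hs, Int.ediv_nonneg hj hs.le,
      (Int.mul_ediv_add_emod j s).symm⟩
  have hlB : l * B ≤ (s - 1) * B := mul_le_mul_of_nonneg_right (by linarith) hB0
  -- Row 0 admits exactly z = 0, ..., h. If h ≥ 3 it supplies all four pairs, the costliest being z
  -- = h - 3. Otherwise its h + 1 pairs are completed by the 3 - h largest z of row 1.
  by_cases h3' : 3 ≤ h
  · have hhr : h ≤ r := by
      by_contra hlt
      have : r + 1 ≤ h := by omega
      nlinarith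
    have hbound : l * B + h * C + 3 * (t * A) ≤ M := by
      rcases hhr.lt_or_eq with hlt | rfl
      · have : h * C ≤ (r - 1) * C := mul_le_mul_of_nonneg_right (by omega) (by linarith)
        linarith
      · have : l * B ≤ (e - 1) * B := mul_le_mul_of_nonneg_right (by linarith) hB0
        linarith
    refine ⟨[(0, h), (0, h - 1), (0, h - 2), (0, h - 3)], rfl, by simp; omega, ?_⟩
    simp only [List.forall_mem_cons, List.not_mem_nil, false_imp_iff, implies_true, and_true]
    refine ⟨contribution_le l ?_ ?_ ?_ ?_, contribution_le (l + s) ?_ ?_ ?_ ?_,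
      contribution_le (l + 2 * s) ?_ ?_ ?_ ?_, contribution_le (l + 3 * s) ?_ ?_ ?_ ?_⟩
    all_goals first
      | (rw [hjl]; ring)
      | omega
      | (rw [← hC]; linarith)
  -- Since j + A = (h + r)s + (l + e), the largest z in row 1 is h + r or h + r + 1, according to
  -- whether l + e carries past s. The first case leads to the bound with r + 2, the second to the
  -- one with r + 3.
  · by_cases hc : l + e < s
    · have hlB : (l + e) * B ≤ (s - 1) * B := mul_le_mul_of_nonneg_right (by linarith) hB0
      have hlB' : l * B ≤ (l + e) * B := mul_le_mul_of_nonneg_right (by linarith) hB0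
      obtain rfl | rfl | rfl : h = 2 ∨ h = 1 ∨ h = 0 := by omega
      · refine ⟨[(0, 2), (0, 1), (0, 0), (1, r + 2)], rfl, by simp, ?_⟩
        simp only [List.forall_mem_cons, List.not_mem_nil, false_imp_iff, implies_true, and_true]
        refine ⟨contribution_le l ?_ ?_ ?_ ?_, contribution_le (l + s) ?_ ?_ ?_ ?_,
          contribution_le (l + 2 * s) ?_ ?_ ?_ ?_, contribution_le (l + e) ?_ ?_ ?_ ?_⟩
        all_goals first
          | (rw [hjl]; ring1)
          | (rw [hjl, hA]; ring1)
          | omega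
          | (rw [← hC]; linarith)
      · refine ⟨[(0, 1), (0, 0), (1, r + 1), (1, r)], rfl, by simp, ?_⟩
        simp only [List.forall_mem_cons, List.not_mem_nil, false_imp_iff, implies_true, and_true]
        refine ⟨contribution_le l ?_ ?_ ?_ ?_, contribution_le (l + s) ?_ ?_ ?_ ?_,
          contribution_le (l + e) ?_ ?_ ?_ ?_, contribution_le (l + e + s) ?_ ?_ ?_ ?_⟩
        all_goals first
          | (rw [hjl]; ring1)
          | (rw [hjl, hA]; ring1)
          | omega
          | (rw [← hC]; linarith)
      · refine ⟨[(0, 0), (1, r), (1, r - 1), (1, r - 2)], rfl, by simp; omega, ?_⟩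
        simp only [List.forall_mem_cons, List.not_mem_nil, false_imp_iff, implies_true, and_true]
        refine ⟨contribution_le l ?_ ?_ ?_ ?_, contribution_le (l + e) ?_ ?_ ?_ ?_,
          contribution_le (l + e + s) ?_ ?_ ?_ ?_, contribution_le (l + e + 2 * s) ?_ ?_ ?_ ?_⟩
        all_goals first
          | (rw [hjl]; ring1)
          | (rw [hjl, hA]; ring1)
          | omega
          | (rw [← hC]; linarith)
    · have hlB' : (l + e - s) * B ≤ (e - 1) * B := mul_le_mul_of_nonneg_right (by linarith) hB0
      obtain rfl | rfl | rfl : h = 2 ∨ h = 1 ∨ h = 0 := by omega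
      · refine ⟨[(0, 2), (0, 1), (0, 0), (1, r + 3)], rfl, by simp, ?_⟩
        simp only [List.forall_mem_cons, List.not_mem_nil, false_imp_iff, implies_true, and_true]
        refine ⟨contribution_le l ?_ ?_ ?_ ?_, contribution_le (l + s) ?_ ?_ ?_ ?_,
          contribution_le (l + 2 * s) ?_ ?_ ?_ ?_, contribution_le (l + e - s) ?_ ?_ ?_ ?_⟩
        all_goals first
          | (rw [hjl]; ring1)
          | (rw [hjl, hA]; ring1)
          | omega
          | (rw [← hC]; linarith)
      · refine ⟨[(0, 1), (0, 0), (1, r + 2), (1, r + 1)], rfl, by simp, ?_⟩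
        simp only [List.forall_mem_cons, List.not_mem_nil, false_imp_iff, implies_true, and_true]
        refine ⟨contribution_le l ?_ ?_ ?_ ?_, contribution_le (l + s) ?_ ?_ ?_ ?_,
          contribution_le (l + e - s) ?_ ?_ ?_ ?_, contribution_le (l + e) ?_ ?_ ?_ ?_⟩
        all_goals first
          | (rw [hjl]; ring1)
          | (rw [hjl, hA]; ring1)
          | omega
          | (rw [← hC]; linarith)
      · refine ⟨[(0, 0), (1, r + 1), (1, r), (1, r - 1)], rfl, by simp; omega, ?_⟩
        simp only [List.forall_mem_cons, List.not_mem_nil, false_imp_iff, implies_true, and_true]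
        refine ⟨contribution_le l ?_ ?_ ?_ ?_, contribution_le (l + e - s) ?_ ?_ ?_ ?_,
          contribution_le (l + e) ?_ ?_ ?_ ?_, contribution_le (l + e + s) ?_ ?_ ?_ ?_⟩
        all_goals first
          | (rw [hjl]; ring1)
          | (rw [hjl, hA]; ring1)
          | omega
          | (rw [← hC]; linarith)

/-- The candidate with r + 3 exceeds the one with r + 2 by eB - tA, so it is the maximum here. It is
attained at j = 3s - 1 by the pair (1, r + 3), which leaves y = e - 1. -/
theorem isMaxFourth_of_le {A B s t r e : ℤ} (hA : A = r * s + e) (he : 1 ≤ e) (hes : e ≤ s)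
    (hr : 3 ≤ r) (hB : 2 * A ≤ B) (ht : 0 ≤ t) (hts : 2 * t ≤ s) (h : t * A ≤ e * B) :
    IsMaxFourth A B s t ((e - 1) * B + (r + 3) * (s * B - t * A)) where
  upper := exists_four_contributions hA he hes hr hB ht hts le_rfl (by linarith)
  lower := by
    have hs : 0 < s := by linarith
    have hsA : 3 * s + 1 ≤ A := by nlinarith
    have hstep : 4 * (t * A) ≤ s * B := by
      have := mul_le_mul hts hB (by linarith) hs.le
      linarith
    refine ⟨3 * s - 1, by linarith, by linarith, ⟨B - t * (r + 3), by rw [hA]; ring⟩,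
      [(0, 0), (0, 1), (0, 2)], by simp, fun q z hq hz hqz hlt => ?_⟩
    have hlt' : (q - 1) * B < t * (z - r - 3) := by
      have : A * ((q - 1) * B) < A * (t * (z - r - 3)) := by
        have e1 : (e - 1) * B + (r + 3) * (s * B - t * A)
          = (3 * s - 1) * B + A * (B - t * (r + 3)) := by rw [hA]; ring
        linarith
      exact lt_of_mul_lt_mul_left this (by linarith)
    have hz' : s * (z - r - 3) ≤ e - 1 + (q - 1) * A := by
      have : s * r = A - e := by rw [hA]; ring
      linarith
    rcases hq.lt_or_eq with hq | rfl
    -- Eliminating z between `hlt'` and `hz'` excludes q ≥ 2, because 4tA ≤ sB. For q = 1 the room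
    -- left is e - 1 < s, so z cannot exceed r + 3.
    · exfalso
      have hz1 : s * ((q - 1) * B) < t * (e - 1 + (q - 1) * A) := by
        calc s * ((q - 1) * B) < s * (t * (z - r - 3)) := mul_lt_mul_of_pos_left hlt' hs
          _ = t * (s * (z - r - 3)) := by ring
          _ ≤ _ := mul_le_mul_of_nonneg_left hz' ht
      rcases (show (1 : ℤ) ≤ q by omega).lt_or_eq with hq1 | rfl
      · have h1 : e - 1 + (q - 1) * A ≤ 2 * ((q - 1) * A) := by nlinarith
        have h2 := mul_le_mul_of_nonneg_left h1 ht
        have h3 := mul_le_mul_of_nonneg_left hstep (show 0 ≤ q - 1 by omega)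
        have h4 : 0 ≤ (q - 1) * (t * A) :=
          mul_nonneg (by omega) (mul_nonneg ht (by linarith))
        linarith
      · have : z - r - 3 ≤ 0 := by
          by_contra hneg
          have : 1 ≤ z - r - 3 := by omega
          nlinarith
        nlinarith
    · have : z < 3 := by nlinarith
      interval_cases z <;> simp

/-- Now the candidate with r + 2 wins. The residue is chosen so that the pair (1, r + 2) leaves y =
s - 1, the largest value without a carry. -/
theorem isMaxFourth_of_lt {A B s t r e : ℤ} (hA : A = r * s + e) (he : 1 ≤ e) (hes : e ≤ s)
    (hr : 3 ≤ r) (hB : 2 * A ≤ B) (ht : 0 ≤ t) (hts : 2 * t ≤ s) (h : e * B < t * A) :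
    IsMaxFourth A B s t ((s - 1) * B + (r + 2) * (s * B - t * A)) where
  upper := exists_four_contributions hA he hes hr hB ht hts (by linarith) le_rfl
  lower := by
    have hs : 0 < s := by linarith
    have hsA : 3 * s + 1 ≤ A := by nlinarith
    have hstep : 4 * (t * A) ≤ s * B := by
      have := mul_le_mul hts hB (by linarith) hs.le
      linarith
    refine ⟨3 * s - 1 - e, by linarith, by linarith, ⟨B - t * (r + 2), by rw [hA]; ring⟩,
      [(0, 0), (0, 1), (0, 2)], by simp, fun q z hq hz hqz hlt => ?_⟩
    have hlt' : (q - 1) * B < t * (z - r - 2) := by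
      have : A * ((q - 1) * B) < A * (t * (z - r - 2)) := by
        have e1 : (s - 1) * B + (r + 2) * (s * B - t * A)
          = (3 * s - 1 - e) * B + A * (B - t * (r + 2)) := by rw [hA]; ring
        linarith
      exact lt_of_mul_lt_mul_left this (by linarith)
    have hz' : s * (z - r - 2) ≤ s - 1 + (q - 1) * A := by
      have : s * r = A - e := by rw [hA]; ring
      linarith
    rcases hq.lt_or_eq with hq | rfl
    · exfalso
      have hz1 : s * ((q - 1) * B) < t * (s - 1 + (q - 1) * A) := by
        calc s * ((q - 1) * B) < s * (t * (z - r - 2)) := mul_lt_mul_of_pos_left hlt' hs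
          _ = t * (s * (z - r - 2)) := by ring
          _ ≤ _ := mul_le_mul_of_nonneg_left hz' ht
      rcases (show (1 : ℤ) ≤ q by omega).lt_or_eq with hq1 | rfl
      · have h1 : s - 1 + (q - 1) * A ≤ 2 * ((q - 1) * A) := by nlinarith
        have h2 := mul_le_mul_of_nonneg_left h1 ht
        have h3 := mul_le_mul_of_nonneg_left hstep (show 0 ≤ q - 1 by omega)
        have h4 : 0 ≤ (q - 1) * (t * A) :=
          mul_nonneg (by omega) (mul_nonneg ht (by linarith))
        linarith
      · have : z - r - 2 ≤ 0 := by
          by_contra hneg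
          have : 1 ≤ z - r - 2 := by omega
          nlinarith
        nlinarith
    · have : z < 3 := by nlinarith
      interval_cases z <;> simp

/-! ### Large third index and the cases k = i+2, ..., i-2 -/

lemma weight_lt {A B j w w' M : ℤ} (hA : 0 < A) (h : j * B + A * w < M)
    (hM : M = j * B + A * w') : w < w' :=
  lt_of_mul_lt_mul_left (by linarith) hA.le

/-- The third number is too costly to help: the four smallest contributions at j = A - 1 come from z
= 0 and q = 0, 1, 2, 3. -/
theorem isMaxFourth_of_large {A B s t : ℤ} (hA : 0 < A) (hB : 0 ≤ B) (hs : 0 ≤ s)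
    (h : 4 * A ≤ s ∧ t ≤ B ∨ 4 * A * B ≤ s * B - t * A) :
    IsMaxFourth A B s t ((4 * A - 1) * B) where
  upper j hj hjA := by
    refine ⟨[(0, 0), (1, 0), (2, 0), (3, 0)], rfl, by simp, ?_⟩
    simp only [List.forall_mem_cons, List.not_mem_nil, false_imp_iff, implies_true, and_true]
    have hjB : (j + 3 * A) * B ≤ (4 * A - 1) * B := mul_le_mul_of_nonneg_right (by linarith) hB
    have hAB : 0 ≤ A * B := by positivity
    refine ⟨contribution_le j ?_ ?_ ?_ ?_, contribution_le (j + A) ?_ ?_ ?_ ?_,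
      contribution_le (j + 2 * A) ?_ ?_ ?_ ?_, contribution_le (j + 3 * A) ?_ ?_ ?_ ?_⟩ <;>
    linarith
  lower := by
    refine ⟨A - 1, by linarith, by linarith, ⟨3 * B, by ring⟩, [(0, 0), (1, 0), (2, 0)], by simp,
      fun q z hq hz hqz hlt => ?_⟩
    have hw := weight_lt hA hlt (w' := 3 * B) (by ring)
    rcases hz.lt_or_eq with hz | rfl
    · exfalso
      -- The first alternative serves k = i + 3, where C may lie below M (34 < 35 for i = 3). There
      -- each unit of z forces four units of q, so the weight qB - tz is still at least 3B.
      rcases h with ⟨h1, h2⟩ | h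
      · have h4 : 4 * z ≤ q := by
          by_contra hneg
          have : q + 1 ≤ 4 * z := by omega
          nlinarith
        have h5 : t * z ≤ B * z := mul_le_mul_of_nonneg_right h2 hz.le
        have h6 : 4 * z * B ≤ q * B := mul_le_mul_of_nonneg_right h4 hB
        have h7 : 1 * B ≤ z * B := mul_le_mul_of_nonneg_right (by omega) hB
        linarith
      · have h1 : 0 ≤ (A - 1 + q * A - s * z) * B := mul_nonneg (by linarith) hB
        have h2 : 1 * (s * B - t * A) ≤ z * (s * B - t * A) :=
          mul_le_mul_of_nonneg_right (by omega) (le_trans (by positivity) h)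
        linarith
    · have : q < 3 := by
        by_contra hneg
        have : 3 ≤ q := by omega
        nlinarith
      interval_cases q <;> simp

/-- Case k = i + 2 with c = F_{i-1}. The pair (2, 1) needs j ≥ c; below that (3, 1) replaces it, and
j = c - 1 is the extreme residue. -/
theorem isMaxFourth_index_add_two {A c : ℤ} (hc : 1 ≤ c) (hcA : c ≤ A) (hAc : A ≤ 2 * c) :
    IsMaxFourth A (2 * A + c) (2 * A + c) A
      ((A - 1) * (2 * A + c) + ((2 * A + c) * (2 * A + c) - A * A)) where
  upper j hj hjA := by
    have hAA : 0 ≤ A * A := mul_self_nonneg A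
    have hcc : 0 ≤ c * A := by nlinarith
    have hq : 2 * A * (2 * A + c) ≤ (2 * A + c) * (2 * A + c) - A * A := by nlinarith
    have hjB : j * (2 * A + c) ≤ (A - 1) * (2 * A + c) :=
      mul_le_mul_of_nonneg_right (by linarith) (by linarith)
    by_cases hjc : c ≤ j
    · refine ⟨[(0, 0), (1, 0), (2, 0), (2, 1)], rfl, by simp, ?_⟩
      simp only [List.forall_mem_cons, List.not_mem_nil, false_imp_iff, implies_true, and_true]
      refine ⟨contribution_le j ?_ ?_ ?_ ?_, contribution_le (j + A) ?_ ?_ ?_ ?_,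
        contribution_le (j + 2 * A) ?_ ?_ ?_ ?_, contribution_le (j - c) ?_ ?_ ?_ ?_⟩
      all_goals linarith
    · refine ⟨[(0, 0), (1, 0), (2, 0), (3, 1)], rfl, by simp, ?_⟩
      simp only [List.forall_mem_cons, List.not_mem_nil, false_imp_iff, implies_true, and_true]
      have hjB : (j + (A - c)) * (2 * A + c) ≤ (A - 1) * (2 * A + c) :=
        mul_le_mul_of_nonneg_right (by omega) (by linarith)
      refine ⟨contribution_le j ?_ ?_ ?_ ?_, contribution_le (j + A) ?_ ?_ ?_ ?_,
        contribution_le (j + 2 * A) ?_ ?_ ?_ ?_, contribution_le (j + (A - c)) ?_ ?_ ?_ ?_⟩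
      all_goals linarith
  lower := by
    refine ⟨c - 1, by linarith, by linarith, ⟨3 * (2 * A + c) - A, by ring⟩,
      [(0, 0), (1, 0), (2, 0)], by simp, fun q z hq hz hqz hlt => ?_⟩
    have hw := weight_lt (by linarith) hlt (w' := 3 * (2 * A + c) - A) (by ring)
    have hz1 : (z - 1) * (2 * A + c) ≤ (q - 2) * A - 1 := by linarith
    rcases lt_or_ge q 3 with hq3 | hq3
    · have : z < 1 := by
        by_contra hneg
        have : 1 ≤ z := by omega
        nlinarith
      obtain rfl : z = 0 := by omega
      interval_cases q <;> simp
    · exfalso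
      -- As s > 2A, each further unit of z costs two rows, and 2B outweighs the gain t. The later
      -- cases use similar linear bounds on z in terms of q.
      have h1 : 2 * (z - 1) ≤ q - 3 := by
        by_contra hneg
        have : q - 2 ≤ 2 * (z - 1) := by omega
        nlinarith
      nlinarith

/-- Case k = i + 1, with c = F_{i-1} and d = F_{i-2}. The maximum is attained at j = A - 1 by the
pair (2, 1). -/
theorem isMaxFourth_index_add_one {c d : ℤ} (hd : 1 ≤ d) (hdc : d ≤ c) (hcd : c ≤ 2 * d) :
    IsMaxFourth (c + d) (3 * c + 2 * d) (2 * c + d) c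
      ((c + d + d - 1) * (3 * c + 2 * d) +
        ((2 * c + d) * (3 * c + 2 * d) - c * (c + d))) where
  upper j hj hjA := by
    have hd0 : 0 ≤ d * d := mul_self_nonneg d
    have hdd : d * d ≤ c * d := mul_le_mul_of_nonneg_right hdc (by linarith)
    have hcc : c * d ≤ c * c := mul_le_mul_of_nonneg_left hdc (by linarith)
    have hcc' : c * c ≤ c * (2 * d) := mul_le_mul_of_nonneg_left hcd (by linarith)
    have hjB : j * (3 * c + 2 * d) ≤ (c + d - 1) * (3 * c + 2 * d) :=
      mul_le_mul_of_nonneg_right (by linarith) (by linarith)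
    by_cases hjc : c ≤ j
    · refine ⟨[(0, 0), (1, 0), (1, 1), (2, 1)], rfl, by simp, ?_⟩
      simp only [List.forall_mem_cons, List.not_mem_nil, false_imp_iff, implies_true, and_true]
      refine ⟨contribution_le j ?_ ?_ ?_ ?_, contribution_le (j + (c + d)) ?_ ?_ ?_ ?_,
        contribution_le (j - c) ?_ ?_ ?_ ?_, contribution_le (j + d) ?_ ?_ ?_ ?_⟩
      all_goals linarith
    · refine ⟨[(0, 0), (1, 0), (2, 0), (2, 1)], rfl, by simp, ?_⟩
      simp only [List.forall_mem_cons, List.not_mem_nil, false_imp_iff, implies_true, and_true]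
      have hjB : j * (3 * c + 2 * d) ≤ (c - 1) * (3 * c + 2 * d) :=
        mul_le_mul_of_nonneg_right (by omega) (by linarith)
      refine ⟨contribution_le j ?_ ?_ ?_ ?_, contribution_le (j + (c + d)) ?_ ?_ ?_ ?_,
        contribution_le (j + 2 * (c + d)) ?_ ?_ ?_ ?_, contribution_le (j + d) ?_ ?_ ?_ ?_⟩
      all_goals linarith
  lower := by
    refine ⟨c + d - 1, by linarith, by linarith, ⟨2 * (3 * c + 2 * d) - c, by ring⟩,
      [(0, 0), (1, 0), (1, 1)], by simp, fun q z hq hz hqz hlt => ?_⟩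
    have hw := weight_lt (by linarith) hlt (w' := 2 * (3 * c + 2 * d) - c) (by ring)
    rcases lt_or_ge q 2 with hq2 | hq2
    · interval_cases q
      · have : z < 1 := by
          by_contra hneg
          have : 1 ≤ z := by omega
          nlinarith
        interval_cases z; simp
      · have : z < 2 := by
          by_contra hneg
          have : 2 ≤ z := by omega
          nlinarith
        interval_cases z <;> simp
    · exfalso
      have h1 : z - 1 ≤ 2 * (q - 2) := by
        rcases hq2.lt_or_eq with hq2 | rfl
        · by_contra hneg
          have : q + 1 ≤ z := by omega
          nlinarith
        · by_contra hneg
          have : 2 ≤ z := by omega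
          nlinarith
      nlinarith

/-- Case k = i, so s = A and admissibility is just z ≤ q for every j. The pair (2, 2) is decisive.
-/
theorem isMaxFourth_index {c d : ℤ} (hd : 1 ≤ d) (hdc : d ≤ c) :
    IsMaxFourth (c + d) (3 * c + 2 * d) (c + d) d
      ((c + d - 1) * (3 * c + 2 * d) +
        2 * ((c + d) * (3 * c + 2 * d) - d * (c + d))) where
  upper j hj hjA := by
    have hdd : 0 ≤ d * d := mul_self_nonneg d
    have hcc : 0 ≤ c * d := mul_nonneg (by linarith) (by linarith)
    have hjB : j * (3 * c + 2 * d) ≤ (c + d - 1) * (3 * c + 2 * d) :=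
      mul_le_mul_of_nonneg_right (by linarith) (by linarith)
    refine ⟨[(0, 0), (1, 0), (1, 1), (2, 2)], rfl, by simp, ?_⟩
    simp only [List.forall_mem_cons, List.not_mem_nil, false_imp_iff, implies_true, and_true]
    refine ⟨contribution_le j ?_ ?_ ?_ ?_, contribution_le (j + (c + d)) ?_ ?_ ?_ ?_,
      contribution_le j ?_ ?_ ?_ ?_, contribution_le j ?_ ?_ ?_ ?_⟩
    all_goals first | linarith | nlinarith
  lower := by
    refine ⟨c + d - 1, by linarith, by linarith, ⟨2 * (3 * c + 2 * d) - d * 2, by ring⟩,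
      [(0, 0), (1, 0), (1, 1)], by simp, fun q z hq hz hqz hlt => ?_⟩
    have hw := weight_lt (by linarith) hlt (w' := 2 * (3 * c + 2 * d) - d * 2) (by ring)
    have hzq : z ≤ q := by
      by_contra hneg
      have : q + 1 ≤ z := by omega
      nlinarith
    rcases lt_or_ge q 2 with hq2 | hq2
    · interval_cases q <;> interval_cases z <;> simp
    · nlinarith

/-- Case k = i - 1. For j < c - d row 1 admits only z ≤ 1, so the pair (2, 3) is needed; its worst
residue is j = c - d - 1. -/
theorem isMaxFourth_index_sub_one {c d : ℤ} (hd : 1 ≤ d) (hdc : d < c) (hcd : c ≤ 2 * d) :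
    IsMaxFourth (c + d) (3 * c + 2 * d) c (c - d)
      ((d - 1) * (3 * c + 2 * d) + 3 * (c * (3 * c + 2 * d) - (c - d) * (c + d))) where
  upper j hj hjA := by
    have hd0 : 0 ≤ d * d := mul_self_nonneg d
    have hdd : d * d ≤ c * d := mul_le_mul_of_nonneg_right hdc.le (by linarith)
    have hcc : c * d ≤ c * c := mul_le_mul_of_nonneg_left hdc.le (by linarith)
    have hcc' : c * c ≤ c * (2 * d) := mul_le_mul_of_nonneg_left hcd (by linarith)
    by_cases hjc : c ≤ j
    · have hjB : j * (3 * c + 2 * d) ≤ (c + d - 1) * (3 * c + 2 * d) :=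
        mul_le_mul_of_nonneg_right (by linarith) (by linarith)
      refine ⟨[(0, 0), (0, 1), (1, 2), (1, 1)], rfl, by simp, ?_⟩
      simp only [List.forall_mem_cons, List.not_mem_nil, false_imp_iff, implies_true, and_true]
      refine ⟨contribution_le j ?_ ?_ ?_ ?_, contribution_le (j - c) ?_ ?_ ?_ ?_,
        contribution_le (j + d - c) ?_ ?_ ?_ ?_, contribution_le (j + d) ?_ ?_ ?_ ?_⟩
      all_goals linarith
    · have hjB : j * (3 * c + 2 * d) ≤ (c - 1) * (3 * c + 2 * d) :=
        mul_le_mul_of_nonneg_right (by omega) (by linarith)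
      by_cases hjd : c ≤ j + d
      · refine ⟨[(0, 0), (1, 0), (1, 1), (1, 2)], rfl, by simp, ?_⟩
        simp only [List.forall_mem_cons, List.not_mem_nil, false_imp_iff, implies_true, and_true]
        refine ⟨contribution_le j ?_ ?_ ?_ ?_, contribution_le (j + c + d) ?_ ?_ ?_ ?_,
          contribution_le (j + d) ?_ ?_ ?_ ?_, contribution_le (j + d - c) ?_ ?_ ?_ ?_⟩
        all_goals linarith
      · have hjB' : j * (3 * c + 2 * d) ≤ (c - d - 1) * (3 * c + 2 * d) :=
          mul_le_mul_of_nonneg_right (by omega) (by linarith)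
        refine ⟨[(0, 0), (1, 0), (1, 1), (2, 3)], rfl, by simp, ?_⟩
        simp only [List.forall_mem_cons, List.not_mem_nil, false_imp_iff, implies_true, and_true]
        refine ⟨contribution_le j ?_ ?_ ?_ ?_, contribution_le (j + c + d) ?_ ?_ ?_ ?_,
          contribution_le (j + d) ?_ ?_ ?_ ?_, contribution_le (j + 2 * d - c) ?_ ?_ ?_ ?_⟩
        all_goals linarith
  lower := by
    refine ⟨c - d - 1, by linarith, by linarith, ⟨2 * (3 * c + 2 * d) - (c - d) * 3, by ring⟩,
      [(0, 0), (1, 0), (1, 1)], by simp, fun q z hq hz hqz hlt => ?_⟩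
    have hw := weight_lt (by linarith) hlt (w' := 2 * (3 * c + 2 * d) - (c - d) * 3) (by ring)
    rcases lt_or_ge q 2 with hq2 | hq2
    · interval_cases q
      · have : z < 1 := by
          by_contra hneg
          have : 1 ≤ z := by omega
          nlinarith
        interval_cases z; simp
      · have : z < 2 := by
          by_contra hneg
          have : 2 ≤ z := by omega
          nlinarith
        interval_cases z <;> simp
    · exfalso
      have h1 : z - 3 ≤ 3 * (q - 2) := by
        rcases hq2.lt_or_eq with hq2 | rfl
        · by_contra hneg
          have : 3 * q - 2 ≤ z := by omega
          nlinarith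
        · by_contra hneg
          have : 4 ≤ z := by omega
          nlinarith
      have h2 := mul_le_mul_of_nonneg_left h1 (show 0 ≤ c - d by linarith)
      nlinarith

/-- Case k = i - 2, with t = F_{i-4} and v = F_{i-5}. At j = A - 1 the pair (1, 5) leaves y = v - 1,
which requires v ≥ 1. -/
theorem isMaxFourth_index_sub_two {t v : ℤ} (hv : 1 ≤ v) (hvt : v ≤ t) (htv : t ≤ 2 * v) :
    IsMaxFourth (5 * t + 3 * v) (13 * t + 8 * v) (2 * t + v) t
      ((v - 1) * (13 * t + 8 * v) +
        5 * ((2 * t + v) * (13 * t + 8 * v) - t * (5 * t + 3 * v))) where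
  upper j hj hjA := by
    have hv0 : 0 ≤ v * v := mul_self_nonneg v
    have hvv : v * v ≤ t * v := mul_le_mul_of_nonneg_right hvt (by linarith)
    have htt : t * v ≤ t * t := mul_le_mul_of_nonneg_left hvt (by linarith)
    have htt' : t * t ≤ t * (2 * v) := mul_le_mul_of_nonneg_left htv (by linarith)
    rcases lt_or_ge j (2 * t + v) with h1 | h1
    · have hjB : j * (13 * t + 8 * v) ≤ (2 * t + v - 1) * (13 * t + 8 * v) :=
        mul_le_mul_of_nonneg_right (by linarith) (by linarith)
      refine ⟨[(0, 0), (1, 2), (1, 1), (1, 0)], rfl, by simp, ?_⟩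
      simp only [List.forall_mem_cons, List.not_mem_nil, false_imp_iff, implies_true, and_true]
      refine ⟨contribution_le j ?_ ?_ ?_ ?_, contribution_le (j + t + v) ?_ ?_ ?_ ?_,
        contribution_le (j + 3 * t + 2 * v) ?_ ?_ ?_ ?_,
        contribution_le (j + 5 * t + 3 * v) ?_ ?_ ?_ ?_⟩
      all_goals linarith
    · rcases lt_or_ge j (4 * t + 2 * v) with h2 | h2
      · have hjB : j * (13 * t + 8 * v) ≤ (4 * t + 2 * v - 1) * (13 * t + 8 * v) :=
          mul_le_mul_of_nonneg_right (by linarith) (by linarith)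
        refine ⟨[(0, 1), (0, 0), (1, 3), (1, 2)], rfl, by simp, ?_⟩
        simp only [List.forall_mem_cons, List.not_mem_nil, false_imp_iff, implies_true, and_true]
        refine ⟨contribution_le (j - 2 * t - v) ?_ ?_ ?_ ?_, contribution_le j ?_ ?_ ?_ ?_,
          contribution_le (j - t) ?_ ?_ ?_ ?_, contribution_le (j + t + v) ?_ ?_ ?_ ?_⟩
        all_goals linarith
      · have hjB : j * (13 * t + 8 * v) ≤ (5 * t + 3 * v - 1) * (13 * t + 8 * v) :=
          mul_le_mul_of_nonneg_right (by linarith) (by linarith)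
        by_cases h3 : 5 * t + 2 * v ≤ j
        · refine ⟨[(0, 2), (0, 1), (0, 0), (1, 5)], rfl, by simp, ?_⟩
          simp only [List.forall_mem_cons, List.not_mem_nil, false_imp_iff, implies_true, and_true]
          refine ⟨contribution_le (j - 4 * t - 2 * v) ?_ ?_ ?_ ?_,
            contribution_le (j - 2 * t - v) ?_ ?_ ?_ ?_, contribution_le j ?_ ?_ ?_ ?_,
            contribution_le (j - 5 * t - 2 * v) ?_ ?_ ?_ ?_⟩
          all_goals linarith
        · have hjB : j * (13 * t + 8 * v) ≤ (5 * t + 2 * v - 1) * (13 * t + 8 * v) :=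
            mul_le_mul_of_nonneg_right (by omega) (by linarith)
          refine ⟨[(0, 2), (0, 1), (0, 0), (1, 4)], rfl, by simp, ?_⟩
          simp only [List.forall_mem_cons, List.not_mem_nil, false_imp_iff, implies_true, and_true]
          refine ⟨contribution_le (j - 4 * t - 2 * v) ?_ ?_ ?_ ?_,
            contribution_le (j - 2 * t - v) ?_ ?_ ?_ ?_, contribution_le j ?_ ?_ ?_ ?_,
            contribution_le (j - 3 * t - v) ?_ ?_ ?_ ?_⟩
          all_goals linarith
  lower := by
    refine ⟨5 * t + 3 * v - 1, by linarith, by linarith, ⟨13 * t + 8 * v - t * 5, by ring⟩,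
      [(0, 0), (0, 1), (0, 2)], by simp, fun q z hq hz hqz hlt => ?_⟩
    have hw := weight_lt (by linarith) hlt (w' := 13 * t + 8 * v - t * 5) (by ring)
    rcases hq.lt_or_eq with hq | rfl
    · exfalso
      have h1 : z - 5 ≤ 4 * (q - 1) := by
        rcases (show (1 : ℤ) ≤ q by omega).lt_or_eq with hq2 | rfl
        · by_contra hneg
          have : 4 * q + 2 ≤ z := by omega
          nlinarith
        · by_contra hneg
          have : 6 ≤ z := by omega
          nlinarith
      have h2 := mul_le_mul_of_nonneg_left h1 (show 0 ≤ t by linarith)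
      nlinarith
    · have : z < 3 := by
        by_contra hneg
        have : 3 ≤ z := by omega
        nlinarith
      interval_cases z <;> simp

/-- For i = 5 and k = 3 the previous pattern fails because v = F_0 = 0. The maximum 97 = 13 + 4 · 21
comes from j = 4 and the pair (1, 4). -/
theorem isMaxFourth_five_thirteen : IsMaxFourth 5 13 2 1 97 where
  upper j hj hjA := by
    interval_cases j
    · exact ⟨[(0, 0), (1, 0), (1, 1), (1, 2)], by decide⟩
    · exact ⟨[(0, 0), (1, 1), (1, 2), (1, 3)], by decide⟩
    · exact ⟨[(0, 0), (0, 1), (1, 2), (1, 3)], by decide⟩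
    · exact ⟨[(0, 0), (0, 1), (1, 3), (1, 4)], by decide⟩
    · exact ⟨[(0, 0), (0, 1), (0, 2), (1, 4)], by decide⟩
  lower := by
    refine ⟨4, by norm_num, by norm_num, ⟨9, by norm_num⟩, [(0, 0), (0, 1), (0, 2)], by simp,
      fun q z hq hz hqz hlt => ?_⟩
    obtain rfl : q = 0 := by omega
    have : z < 3 := by omega
    interval_cases z <;> simp

/-! ### Specialization to Fibonacci numbers -/

lemma fibZ_add_two (n : ℕ) : fibZ (n + 2) = fibZ (n + 1) + fibZ n := by
  simp only [fibZ, Nat.fib_add_two]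
  push_cast
  ring

lemma fibZ_pos {n : ℕ} (hn : 1 ≤ n) : 1 ≤ fibZ n := by
  have : 0 < n.fib := Nat.fib_pos.2 hn
  simp only [fibZ]
  omega

lemma fibZ_nonneg (n : ℕ) : 0 ≤ fibZ n := Int.natCast_nonneg _

lemma fibZ_mono {m n : ℕ} (h : m ≤ n) : fibZ m ≤ fibZ n := by
  simpa [fibZ] using Nat.fib_mono h

lemma fibZ_add (i m : ℕ) :
    fibZ (i + m + 2) = fibZ (m + 2) * fibZ (i + 2) - fibZ m * fibZ i := by
  have h : fibZ (i + m + 2) = fibZ i * fibZ (m + 1) + fibZ (i + 1) * fibZ (m + 2) := by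
    simp only [fibZ]
    exact_mod_cast Nat.fib_add i (m + 1)
  rw [h, fibZ_add_two, fibZ_add_two]
  ring

/-- The equations for A, B, s, t let each case substitute linear expressions in two Fibonacci
numbers. The offset of the third index from i is m + 2. -/
theorem isPFrobenius_fibTriple {i m k : ℕ} {A B s t M g : ℤ} (hi : 1 ≤ i) (hk : k = i + m + 2)
    (hA : fibZ i = A) (hB : fibZ (i + 2) = B) (hs : fibZ (m + 2) = s) (ht : fibZ m = t)
    (h : IsMaxFourth A B s t M)
    (hg : fibZ k = s * B - t * A → g = M - A) : IsPFrobenius 3 (fibTriple i k) g := by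
  have hC : fibZ k = s * B - t * A := by rw [hk, fibZ_add, hA, hB, hs, ht]
  rw [hg hC]
  subst hA hB hs ht
  refine h.isPFrobenius (Nat.fib_pos.2 hi) (fibZ_nonneg _) ?_ hC
  rw [Nat.fib_add_two, Nat.coprime_self_add_right]
  exact Nat.fib_coprime_fib_succ i

lemma two_mul_fibZ_le (n : ℕ) : 2 * fibZ n ≤ fibZ (n + 2) := by
  have := fibZ_mono (Nat.le_succ n)
  have := fibZ_add_two n
  linarith

theorem isPFrobenius_fibTriple_large {i k : ℕ} (hi : 3 ≤ i) (hk : i + 3 ≤ k) :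
    IsPFrobenius 3 (fibTriple i (i + k)) ((4 * fibZ i - 1) * fibZ (i + 2) - fibZ i) := by
  obtain ⟨m, rfl⟩ : ∃ m, k = m + 2 := ⟨k - 2, by omega⟩
  refine isPFrobenius_fibTriple (m := m) (by omega) (by omega) rfl rfl rfl rfl
    (isMaxFourth_of_large (fibZ_pos (by omega)) (fibZ_nonneg _) (fibZ_nonneg _) ?_) (fun _ => rfl)
  obtain ⟨n, rfl⟩ : ∃ n, i = n + 3 := ⟨i - 3, by omega⟩
  have h0 := fibZ_nonneg n
  have h1 := fibZ_nonneg (n + 1)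
  have h2 : fibZ (n + 2) = _ := fibZ_add_two n
  have h3 : fibZ (n + 3) = _ := fibZ_add_two (n + 1)
  have h4 : fibZ (n + 4) = _ := fibZ_add_two (n + 2)
  have h5 : fibZ (n + 5) = _ := fibZ_add_two (n + 3)
  have h6 : fibZ (n + 6) = _ := fibZ_add_two (n + 4)
  have h7 : fibZ (n + 7) = _ := fibZ_add_two (n + 5)
  rcases hk.lt_or_eq with hlt | heq
  · right
    rw [← fibZ_add]
    refine le_trans ?_ (fibZ_mono (show (n + 3) + (n + 5) + 2 ≤ (n + 3) + m + 2 by omega))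
    rw [fibZ_add (n + 3) (n + 5)]
    change 4 * fibZ (n + 3) * fibZ (n + 5) ≤
      fibZ (n + 7) * fibZ (n + 5) - fibZ (n + 5) * fibZ (n + 3)
    nlinarith [fibZ_nonneg (n + 5)]
  · left
    obtain rfl : m = n + 4 := by omega
    constructor
    · change 4 * fibZ (n + 3) ≤ fibZ (n + 6)
      linarith
    · change fibZ (n + 4) ≤ fibZ (n + 5)
      linarith

theorem isPFrobenius_fibTriple_two_mul_add_two {i : ℕ} (hi : 3 ≤ i) :
    IsPFrobenius 3 (fibTriple i (2 * i + 2))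
      ((fibZ i - 1) * fibZ (i + 2) + fibZ (2 * i + 2) - fibZ i) := by
  obtain ⟨n, rfl⟩ : ∃ n, i = n + 1 := ⟨i - 1, by omega⟩
  have h0 := fibZ_nonneg (n - 1)
  have h1 : fibZ (n + 1) = fibZ n + fibZ (n - 1) := by
    obtain ⟨n, rfl⟩ : ∃ m, n = m + 1 := ⟨n - 1, by omega⟩
    exact fibZ_add_two n
  have h1' := fibZ_mono (Nat.sub_le n 1)
  have h2 : fibZ (n + 2) = _ := fibZ_add_two n
  have h3 : fibZ (n + 1 + 2) = 2 * fibZ (n + 1) + fibZ n := by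
    rw [fibZ_add_two, h2]
    ring
  refine isPFrobenius_fibTriple (m := n + 1) (by omega) (by omega) rfl h3 h3 rfl
    (isMaxFourth_index_add_two (fibZ_pos (by omega)) (by linarith) (by linarith)) fun hC => ?_
  rw [hC, h3]

theorem isPFrobenius_fibTriple_two_mul_add_one {i : ℕ} (hi : 3 ≤ i) :
    IsPFrobenius 3 (fibTriple i (2 * i + 1))
      ((fibZ i + fibZ (i - 2) - 1) * fibZ (i + 2) + fibZ (2 * i + 1) - fibZ i) := by
  obtain ⟨n, rfl⟩ : ∃ n, i = n + 3 := ⟨i - 3, by omega⟩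
  have h0 := fibZ_nonneg n
  have h01 := fibZ_mono (Nat.le_succ n)
  have h2 : fibZ (n + 2) = _ := fibZ_add_two n
  have h3 : fibZ (n + 3) = _ := fibZ_add_two (n + 1)
  have h4 : fibZ (n + 4) = _ := fibZ_add_two (n + 2)
  have h5 : fibZ (n + 5) = _ := fibZ_add_two (n + 3)
  have hB : fibZ (n + 3 + 2) = 3 * fibZ (n + 2) + 2 * fibZ (n + 1) := by
    change fibZ (n + 5) = _
    linarith
  have hs : fibZ (n + 2 + 2) = 2 * fibZ (n + 2) + fibZ (n + 1) := by
    change fibZ (n + 4) = _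
    linarith
  refine isPFrobenius_fibTriple (m := n + 2) (by omega) (by omega) h3 hB hs rfl
    (isMaxFourth_index_add_one (fibZ_pos (by omega)) (by linarith) (by linarith)) fun hC => ?_
  rw [hC, hB, h3]
  rfl

theorem isPFrobenius_fibTriple_two_mul {i : ℕ} (hi : 3 ≤ i) :
    IsPFrobenius 3 (fibTriple i (2 * i))
      ((fibZ i - 1) * fibZ (i + 2) + 2 * fibZ (2 * i) - fibZ i) := by
  obtain ⟨n, rfl⟩ : ∃ n, i = n + 3 := ⟨i - 3, by omega⟩
  have h0 := fibZ_nonneg n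
  have h2 : fibZ (n + 2) = _ := fibZ_add_two n
  have h3 : fibZ (n + 3) = _ := fibZ_add_two (n + 1)
  have h4 : fibZ (n + 4) = _ := fibZ_add_two (n + 2)
  have h5 : fibZ (n + 5) = _ := fibZ_add_two (n + 3)
  have hB : fibZ (n + 3 + 2) = 3 * fibZ (n + 2) + 2 * fibZ (n + 1) := by
    change fibZ (n + 5) = _
    linarith
  refine isPFrobenius_fibTriple (m := n + 1) (by omega) (by omega) h3 hB h3 rfl
    (isMaxFourth_index (fibZ_pos (by omega)) (by linarith)) fun hC => ?_
  rw [hC, hB, h3]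

theorem isPFrobenius_fibTriple_two_mul_sub_one {i : ℕ} (hi : 4 ≤ i) :
    IsPFrobenius 3 (fibTriple i (2 * i - 1))
      ((fibZ (i - 2) - 1) * fibZ (i + 2) + 3 * fibZ (2 * i - 1) - fibZ i) := by
  obtain ⟨n, rfl⟩ : ∃ n, i = n + 3 := ⟨i - 3, by omega⟩
  have h0 := fibZ_pos (show 1 ≤ n by omega)
  have h01 := fibZ_mono (Nat.le_succ n)
  have h2 : fibZ (n + 2) = _ := fibZ_add_two n
  have h3 : fibZ (n + 3) = _ := fibZ_add_two (n + 1)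
  have h4 : fibZ (n + 4) = _ := fibZ_add_two (n + 2)
  have h5 : fibZ (n + 5) = _ := fibZ_add_two (n + 3)
  have hB : fibZ (n + 3 + 2) = 3 * fibZ (n + 2) + 2 * fibZ (n + 1) := by
    change fibZ (n + 5) = _
    linarith
  refine isPFrobenius_fibTriple (m := n) (by omega) (by omega) h3 hB rfl
    (show fibZ n = fibZ (n + 2) - fibZ (n + 1) by linarith)
    (isMaxFourth_index_sub_one (fibZ_pos (by omega)) (by linarith) (by linarith)) fun hC => ?_
  rw [hC, hB, h3]
  rfl

theorem isPFrobenius_fibTriple_two_mul_sub_two {i : ℕ} (hi : 6 ≤ i) :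
    IsPFrobenius 3 (fibTriple i (2 * i - 2))
      ((fibZ (i - 5) - 1) * fibZ (i + 2) + 5 * fibZ (2 * i - 2) - fibZ i) := by
  obtain ⟨n, rfl⟩ : ∃ n, i = n + 6 := ⟨i - 6, by omega⟩
  have h0 := fibZ_nonneg n
  have h01 := fibZ_mono (Nat.le_succ n)
  have h2 : fibZ (n + 2) = _ := fibZ_add_two n
  have h3 : fibZ (n + 3) = _ := fibZ_add_two (n + 1)
  have h4 : fibZ (n + 4) = _ := fibZ_add_two (n + 2)
  have h5 : fibZ (n + 5) = _ := fibZ_add_two (n + 3)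
  have h6 : fibZ (n + 6) = _ := fibZ_add_two (n + 4)
  have h7 : fibZ (n + 7) = _ := fibZ_add_two (n + 5)
  have h8 : fibZ (n + 8) = _ := fibZ_add_two (n + 6)
  have hA : fibZ (n + 6) = 5 * fibZ (n + 2) + 3 * fibZ (n + 1) := by linarith
  have hB : fibZ (n + 6 + 2) = 13 * fibZ (n + 2) + 8 * fibZ (n + 1) := by
    change fibZ (n + 8) = _
    linarith
  have hs : fibZ (n + 2 + 2) = 2 * fibZ (n + 2) + fibZ (n + 1) := by
    change fibZ (n + 4) = _
    linarith
  refine isPFrobenius_fibTriple (m := n + 2) (by omega) (by omega) hA hB hs rfl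
    (isMaxFourth_index_sub_two (fibZ_pos (by omega)) (by linarith) (by linarith)) fun hC => ?_
  rw [hC, hB, hA]
  rfl

/-- The threshold comes from F_{k+2} = 2F_k + F_{k-1} ≤ 3F_k and F_{k+3} = 3F_k + 2F_{k-1} > 3F_k.
-/
lemma three_le_fib_div_iff {i k : ℕ} (hi : 3 ≤ i) (hk : 3 ≤ k) :
    3 ≤ (Nat.fib i - 1) / Nat.fib k ↔ k + 3 ≤ i := by
  have hpos : 0 < Nat.fib k := Nat.fib_pos.2 (by omega)
  have hipos : 0 < Nat.fib i := Nat.fib_pos.2 (by omega)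
  rw [Nat.le_div_iff_mul_le hpos]
  obtain ⟨n, rfl⟩ : ∃ n, k = n + 1 := ⟨k - 1, by omega⟩
  have hn : 0 < Nat.fib n := Nat.fib_pos.2 (by omega)
  have hmono := Nat.fib_mono (Nat.le_succ n)
  have h2 : Nat.fib (n + 2) = _ := Nat.fib_add_two (n := n)
  have h3 : Nat.fib (n + 3) = _ := Nat.fib_add_two (n := n + 1)
  have h4 : Nat.fib (n + 4) = _ := Nat.fib_add_two (n := n + 2)
  simp only [Nat.succ_eq_add_one, add_assoc, Nat.reduceAdd] at *
  constructor
  · intro h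
    by_contra hlt
    have := Nat.fib_mono (show i ≤ n + 3 by omega)
    omega
  · intro h
    have := Nat.fib_mono h
    omega

theorem isPFrobenius_fibTriple_small {i k : ℕ} {r : ℤ} (hi : 3 ≤ i) (hk : 3 ≤ k) (hr : 3 ≤ r)
    (hlt : r * fibZ k + 1 ≤ fibZ i) (hle : fibZ i ≤ (r + 1) * fibZ k) :
    (fibZ (k - 2) * fibZ i ≤ (fibZ i - r * fibZ k) * fibZ (i + 2) →
      IsPFrobenius 3 (fibTriple i (i + k))
        ((fibZ i - r * fibZ k - 1) * fibZ (i + 2) + (r + 3) * fibZ (i + k) - fibZ i)) ∧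
    ((fibZ i - r * fibZ k) * fibZ (i + 2) < fibZ (k - 2) * fibZ i →
      IsPFrobenius 3 (fibTriple i (i + k))
        ((fibZ k - 1) * fibZ (i + 2) + (r + 2) * fibZ (i + k) - fibZ i)) := by
  obtain ⟨m, rfl⟩ : ∃ m, k = m + 2 := ⟨k - 2, by omega⟩
  rw [Nat.add_sub_cancel]
  have hA : fibZ i = r * fibZ (m + 2) + (fibZ i - r * fibZ (m + 2)) := by ring
  constructor
  · intro h
    refine isPFrobenius_fibTriple (m := m) (by omega) (by omega) rfl rfl rfl rfl
      (isMaxFourth_of_le hA (by linarith) (by linarith) hr (two_mul_fibZ_le i) (fibZ_nonneg m)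
        (two_mul_fibZ_le m) h) fun hC => by rw [hC]
  · intro h
    refine isPFrobenius_fibTriple (m := m) (by omega) (by omega) rfl rfl rfl rfl
      (isMaxFourth_of_lt hA (by linarith) (by linarith) hr (two_mul_fibZ_le i) (fibZ_nonneg m)
        (two_mul_fibZ_le m) h) fun hC => by rw [hC]

theorem theorem4 (i : ℕ) (hi : 3 ≤ i) :
    (∀ k : ℕ, i + 3 ≤ k →
      IsPFrobenius 3 (fibTriple i (i + k))
        ((4 * fibZ i - 1) * fibZ (i + 2) - fibZ i)) ∧
    IsPFrobenius 3 (fibTriple i (2 * i + 2))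
      ((fibZ i - 1) * fibZ (i + 2) + fibZ (2 * i + 2) - fibZ i) ∧
    IsPFrobenius 3 (fibTriple i (2 * i + 1))
      ((fibZ i + fibZ (i - 2) - 1) * fibZ (i + 2) + fibZ (2 * i + 1) - fibZ i) ∧
    IsPFrobenius 3 (fibTriple i (2 * i))
      ((fibZ i - 1) * fibZ (i + 2) + 2 * fibZ (2 * i) - fibZ i) ∧
    (4 ≤ i →
      IsPFrobenius 3 (fibTriple i (2 * i - 1))
        ((fibZ (i - 2) - 1) * fibZ (i + 2) + 3 * fibZ (2 * i - 1) - fibZ i)) ∧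
    (6 ≤ i →
      IsPFrobenius 3 (fibTriple i (2 * i - 2))
        ((fibZ (i - 5) - 1) * fibZ (i + 2) + 5 * fibZ (2 * i - 2) - fibZ i)) ∧
    (i = 5 →
      IsPFrobenius 3 (fibTriple i (2 * i - 2))
        (fibZ (i + 2) + 4 * fibZ (2 * i - 2) - fibZ i) ∧
      fibZ (i + 2) + 4 * fibZ (2 * i - 2) - fibZ i = 92) ∧
    (∀ k r : ℕ, 3 ≤ k → r = (Nat.fib i - 1) / Nat.fib k →
      (3 ≤ r ↔ k + 3 ≤ i) ∧
      (3 ≤ r →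
        (fibZ (k - 2) * fibZ i ≤ (fibZ i - r * fibZ k) * fibZ (i + 2) →
          IsPFrobenius 3 (fibTriple i (i + k))
            ((fibZ i - r * fibZ k - 1) * fibZ (i + 2) + (r + 3) * fibZ (i + k) - fibZ i)) ∧
        ((fibZ i - r * fibZ k) * fibZ (i + 2) < fibZ (k - 2) * fibZ i →
          IsPFrobenius 3 (fibTriple i (i + k))
            ((fibZ k - 1) * fibZ (i + 2) + (r + 2) * fibZ (i + k) - fibZ i)))) := by
  refine ⟨fun k hk => isPFrobenius_fibTriple_large hi hk,
    isPFrobenius_fibTriple_two_mul_add_two hi, isPFrobenius_fibTriple_two_mul_add_one hi,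
    isPFrobenius_fibTriple_two_mul hi, isPFrobenius_fibTriple_two_mul_sub_one,
    isPFrobenius_fibTriple_two_mul_sub_two, ?_, ?_⟩
  · rintro rfl
    refine ⟨?_, by norm_num [fibZ, Nat.fib_add_two]⟩
    exact isPFrobenius_fibTriple (m := 1) (by omega) rfl rfl rfl rfl rfl
      isMaxFourth_five_thirteen fun _ => by norm_num [fibZ, Nat.fib_add_two]
  · rintro k r hk rfl
    refine ⟨three_le_fib_div_iff hi hk, fun hr => ?_⟩
    have hpos : 0 < Nat.fib k := Nat.fib_pos.2 (by omega)
    have hipos : 0 < Nat.fib i := Nat.fib_pos.2 (by omega)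
    -- Dividing F_i - 1 rather than F_i puts the remainder e = F_i - rF_k in the range 1, ..., F_k.
    have h1 := Nat.div_mul_le_self (Nat.fib i - 1) (Nat.fib k)
    have h2 := Nat.lt_mul_of_div_lt (Nat.lt_add_one ((Nat.fib i - 1) / Nat.fib k)) hpos
    refine isPFrobenius_fibTriple_small hi hk (by exact_mod_cast hr) ?_ ?_
    · simp only [fibZ]
      norm_cast
      omega
    · simp only [fibZ]
      norm_cast
      omega
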